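/- **Nonuniqueness.** Let $d=d_1=1$, write $B_2=(-2,2)$, let $$c_1=\frac1{\sqrt{2\pi}}\int_{-2}^{2}e^{-|x|^2/2}\,dx,\qquad c_2=\frac1{\sqrt{8\pi}}\int_{-2}^{2}e^{-|x|^2/8}\,dx ,$$ and $$\lambda_1=\frac{2c_1-c_2-1}{c_1-c_2},\qquad \lambda_2=\frac{2c_1-c_2}{c_1-c_2}.$$ For $t\in[0,1]$, $x\in\mathbb R$ and a probability measure $m$ on $\mathbb R$ put $$\Sigma(t,x)=\lambda_1\mathbf 1_{B_2}(x/\sqrt t)+\lambda_2\mathbf 1_{B_2^c}(x/\sqrt t),\qquad \sigma(t,m)=\int_{\mathbb R}\Sigma(t,x)\,m(dx),\qquad b\equiv 0,$$ where $x/\sqrt t$ is read as $0$ at the single time $t=0$. Then: 1. $(\lambda_1,\lambda_2)$ is the unique solution of the linear system $c_1\lambda_1+(1-c_1)\lambda_2=1$, $c_2\lambda_1+(1-c_2)\lambda_2=2$, and $0<\lambda_1<\lambda_2$. 2. $\lambda_1\le\sigma(t,m)\le\lambda_2$ for all $t\in[0,1]$ and all probability measures $m$; in particular $a=\frac12\sigma^2$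 is uniformly elliptic: there is $\Lambda>1$ with $\Lambda^{-1}\le a\le\Lambda$. 3. There is a constant $C$ such that $|\sigma(t,m)-\sigma(t,m')|\le C\|m-m'\|_{TV}$ for all $t\in[0,1]$ and all probability measures $m,m'$, where $\|m-m'\|_{TV}=|m-m'|(\mathbb R)$. 4. $\sigma(t,\cdot)$ has the uniformly bounded linear functional derivative $\frac{\delta\sigma}{\delta m}(t,m)(y)=\Sigma(t,y)$; its normalized version $\Sigma(t,y)-\sigma(t,m)$, whose integral against $m(dy)$ is $0$, is a uniformly bounded linear functional derivative too. Here, for a smooth, radial, nondecreasing weight $\phi:\mathbb R\to[1,\infty)$ and $\mathcal P_\phi=\{m\text{ a probability measure}:\int\phi\,dm<\infty\}$ with the distance $\|m-m'\|_\phi=\int\phi\,d|m-m'|$, a function $g(m,y)$, Borel measurable in $y$, is called a linear functional derivative of $f:\mathcal P_\phi\to\mathbb R$ if for every compact $K\subset\mathcal P_\phi$ there is $C_K$ with $|g(m,y)|\le C_K\phi(y)$ for all $m\in K$, $y\in\mathbb R$, and $\lim_{\varepsilon\downarrow0}\varepsilon^{-1}\big(f((1-\varepsilon)m+\varepsilon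 m')-f(m)\big)=\int g(m,y)\,(m'-m)(dy)$ for all $m,m'\in\mathcal P_\phi$. The claim holds for every such $\phi$. 5. Let $(W_t)_{t\in[0,1]}$ be a standard one-dimensional Brownian motion on a filtered probability space satisfying the usual conditions, and denote by $[X]$ the law of $X$. Then $\sigma(t,[W_t])=1$ and $\sigma(t,[2W_t])=2$ for all $t\in(0,1]$, and the distribution dependent equation $$dX_t=\sigma(t,[X_t])\,dW_t+b(t,X_t,[X_t])\,dt,\qquad X_0=0,\qquad t\in[0,1],$$ has the two strong solutions $X_t=W_t$ and $X_t=2W_t$ (continuous adapted solutions, also adapted to the completed filtration generated by $W$). They are distinct: $[W_t]\ne[2W_t]$ for every $t\in(0,1]$, and with positive probability the paths $W$ and $2W$ differ. -/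

import Mathlib

open MeasureTheory ProbabilityTheory Filter Topology


noncomputable section

namespace DDSDE

/-! ### Measures on the line, weights and linear functional derivatives -/

/-- The weighted total variation `⟨φ, |m|⟩` of a signed measure `m`. -/
def phiNorm (φ : ℝ → ℝ) (m : SignedMeasure ℝ) : ENNReal :=
  ∫⁻ x, ENNReal.ofReal (φ x) ∂m.totalVariation

/-- The total variation distance `‖m - m'‖_TV = |m - m'|(ℝ)` of two finite measures. -/
def tvDist (m m' : Measure ℝ) [IsFiniteMeasure m] [IsFiniteMeasure m'] : ℝ :=
  (m.toSignedMeasure - m'.toSignedMeasure).totalVariation.real Set.univ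

/-- Admissible weights: smooth, radial and (weakly) increasing functions with values in `[1, ∞)`. -/
structure IsWeight (φ : ℝ → ℝ) : Prop where
  smooth : ContDiff ℝ (⊤ : ℕ∞) φ
  radial_increasing : ∀ x y : ℝ, |x| ≤ |y| → φ x ≤ φ y
  one_le : ∀ x, 1 ≤ φ x

/-- `m ∈ 𝒫_φ(ℝ)`: `m` is a probability measure with `⟨φ, m⟩ < ∞`. -/
structure IsProbWeighted (φ : ℝ → ℝ) (m : Measure ℝ) : Prop where
  isProb : IsProbabilityMeasure m
  integrable : Integrable φ m

/-- The distance `‖m - m'‖_φ`. -/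
def phiDist (φ : ℝ → ℝ) (m m' : Measure ℝ) [IsFiniteMeasure m] [IsFiniteMeasure m'] : ENNReal :=
  phiNorm φ (m.toSignedMeasure - m'.toSignedMeasure)

/-- (Sequentially) compact subsets of the metric space `(𝒫_φ(ℝ), ‖· - ·‖_φ)`. -/
def IsPhiCompact (φ : ℝ → ℝ) (K : Set (Measure ℝ)) : Prop :=
  (∀ m ∈ K, IsProbWeighted φ m) ∧
  ∀ u : ℕ → ProbabilityMeasure ℝ, (∀ n, (u n : Measure ℝ) ∈ K) →
    ∃ m : ProbabilityMeasure ℝ, (m : Measure ℝ) ∈ K ∧ ∃ k : ℕ → ℕ, StrictMono k ∧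
      Tendsto (fun n => phiDist φ (u (k n) : Measure ℝ) (m : Measure ℝ)) atTop (𝓝 0)

/-- The mixture `(1 - ε) m + ε m'`, for `ε ∈ [0, 1]`. -/
def mix (ε : ℝ) (m m' : Measure ℝ) : Measure ℝ :=
  ENNReal.ofReal (1 - ε) • m + ENNReal.ofReal ε • m'

/-- `g` is a linear functional derivative of `f : 𝒫_φ(ℝ) → ℝ`. The values of `f` and `g` outside
`𝒫_φ(ℝ)` are irrelevant. As usual, `g` is determined only up to an additive constant
(depending on `m`). -/
structure HasLinearFunctionalDeriv (φ : ℝ → ℝ) (f : Measure ℝ → ℝ) (g : Measure ℝ → ℝ → ℝ) :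
    Prop where
  measurable : ∀ m, IsProbWeighted φ m → Measurable (g m)
  bound : ∀ K, IsPhiCompact φ K → ∃ C : ℝ, ∀ m ∈ K, ∀ y, |g m y| ≤ C * φ y
  deriv : ∀ m m', IsProbWeighted φ m → IsProbWeighted φ m' →
    Tendsto (fun ε : ℝ => (f (mix ε m m') - f m) / ε) (𝓝[>] 0)
      (𝓝 ((∫ y, g m y ∂m') - ∫ y, g m y ∂m))

/-! ### Stochastic integration on `[0, 1]` -/

section Stochastic

variable {Ω : Type*} [mΩ : MeasurableSpace Ω]

/-- The usual conditions: the filtration is right-continuous and complete. -/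
structure UsualConditions (P : Measure Ω) (𝓕 : Filtration unitInterval mΩ) : Prop where
  rightCont : 𝓕.IsRightContinuous
  complete : ∀ A : Set Ω, P A = 0 → MeasurableSet[𝓕 0] A

/-- `W` is a standard one-dimensional `𝓕`-Brownian motion on `[0, 1]`. -/
structure IsBrownianMotion (P : Measure Ω) (𝓕 : Filtration unitInterval mΩ)
    (W : unitInterval → Ω → ℝ) : Prop where
  adapted : Adapted 𝓕 W
  zero : ∀ᵐ ω ∂P, W 0 ω = 0
  cont : ∀ᵐ ω ∂P, Continuous fun t => W t ω
  indep : ∀ s t : unitInterval, s ≤ t →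
    Indep (MeasurableSpace.comap (fun ω => W t ω - W s ω) inferInstance) (𝓕 s) P
  law : ∀ s t : unitInterval, s ≤ t →
    P.map (fun ω => W t ω - W s ω) = gaussianReal 0 (Real.toNNReal ((t : ℝ) - s))

/-- A simple (elementary predictable) process: bounded coefficients `coef i`, measurable at time
`time i`, on the intervals `(time i, time (i + 1)]`, `i < n`. -/
structure SimpleProcess (𝓕 : Filtration unitInterval mΩ) where
  n : ℕ
  time : Fin (n + 1) → unitInterval
  time_mono : Monotone time
  coef : Fin n → Ω → ℝ
  coef_measurable : ∀ i, Measurable[𝓕 (time i.castSucc)] (coef i)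
  coef_bounded : ∃ C : ℝ, ∀ i ω, |coef i ω| ≤ C

/-- The process `H_s = ∑ᵢ coef i · 1_{(time i, time (i+1)]}(s)`. -/
def SimpleProcess.eval {𝓕 : Filtration unitInterval mΩ} (H : SimpleProcess 𝓕)
    (s : unitInterval) (ω : Ω) : ℝ :=
  ∑ i : Fin H.n, (Set.Ioc (H.time i.castSucc) (H.time i.succ)).indicator (fun _ => H.coef i ω) s

/-- The elementary stochastic integral `∑ᵢ coef i · (W_{time (i+1) ∧ t} - W_{time i ∧ t})`. -/
def SimpleProcess.integral {𝓕 : Filtration unitInterval mΩ} (H : SimpleProcess 𝓕)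
    (W : unitInterval → Ω → ℝ) (t : unitInterval) (ω : Ω) : ℝ :=
  ∑ i : Fin H.n, H.coef i ω * (W (min (H.time i.succ) t) ω - W (min (H.time i.castSucc) t) ω)

/-- The process `J` is (a version of) the Itô integral `J_t = ∫₀ᵗ H_s dW_s`, `t ∈ [0, 1]`, of the
progressively measurable process `H` with `∫₀¹ H_s² ds < ∞` a.s.: `J` is the limit, uniformly in
time and in probability, of elementary integrals of simple processes `S k` with
`∫₀¹ |S k - H|² ds → 0` in probability. This determines `J` up to indistinguishability. -/
structure IsItoIntegral (P : Measure Ω) (𝓕 : Filtration unitInterval mΩ)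
    (W H J : unitInterval → Ω → ℝ) : Prop where
  progressive : IsProgressive 𝓕 H
  sq_integrable : ∀ᵐ ω ∂P, (∫⁻ s : unitInterval, ENNReal.ofReal (H s ω ^ 2)) < ⊤
  adapted : Adapted 𝓕 J
  cont : ∀ᵐ ω ∂P, Continuous fun t => J t ω
  approx : ∃ S : ℕ → SimpleProcess 𝓕,
    (∀ δ : ℝ, 0 < δ → Tendsto (fun k => P {ω | ENNReal.ofReal δ ≤
      ∫⁻ s : unitInterval, ENNReal.ofReal (((S k).eval s ω - H s ω) ^ 2)}) atTop (𝓝 0)) ∧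
    (∀ δ : ℝ, 0 < δ → Tendsto (fun k => P {ω | ∃ t : unitInterval,
      δ ≤ |(S k).integral W t ω - J t ω|}) atTop (𝓝 0))

/-! ### Distribution dependent SDEs on `[0, 1]` with `d = d₁ = 1` -/

/-- `(Ω, 𝓕, P; X, W)` is a weak solution of
`dX_t = σ(t, X_t, [X_t]) dW_t + b(t, X_t, [X_t]) dt`, with `[X_0] = μ₀`. The coefficients are
only ever evaluated at probability measures. -/
structure IsWeakSolution (b σ : unitInterval → ℝ → Measure ℝ → ℝ) (μ₀ : Measure ℝ)
    (P : Measure Ω) (𝓕 : Filtration unitInterval mΩ) (W X : unitInterval → Ω → ℝ) : Prop where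
  isProb : IsProbabilityMeasure P
  usual : UsualConditions P 𝓕
  brownian : IsBrownianMotion P 𝓕 W
  adapted : Adapted 𝓕 X
  cont : ∀ᵐ ω ∂P, Continuous fun t => X t ω
  init : P.map (X 0) = μ₀
  drift_integrable : ∀ᵐ ω ∂P, Integrable fun s : unitInterval => b s (X s ω) (P.map (X s))
  eqn : ∃ J : unitInterval → Ω → ℝ,
    IsItoIntegral P 𝓕 W (fun s ω => σ s (X s ω) (P.map (X s))) J ∧
    ∀ t : unitInterval, ∀ᵐ ω ∂P,
      X t ω = X 0 ω + J t ω + ∫ s in Set.Iic t, b s (X s ω) (P.map (X s))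

/-- The completed σ-algebra at time `t` generated by `ξ` and `(W_s)_{s ≤ t}`. -/
abbrev generatedCompletion (P : Measure Ω) (ξ : Ω → ℝ) (W : unitInterval → Ω → ℝ)
    (t : unitInterval) : MeasurableSpace Ω :=
  MeasurableSpace.comap ξ inferInstance
    ⊔ (⨆ s : Set.Iic t, MeasurableSpace.comap (W s) inferInstance)
    ⊔ MeasurableSpace.generateFrom {A : Set Ω | P A = 0}

/-- `X` is a strong solution with initial value `ξ` driven by `W`: it solves the equation, starts
from `ξ`, and is adapted to the completed filtration generated by `ξ` and `W`. -/
structure IsStrongSolution (b σ : unitInterval → ℝ → Measure ℝ → ℝ) (ξ : Ω → ℝ)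
    (P : Measure Ω) (𝓕 : Filtration unitInterval mΩ) (W X : unitInterval → Ω → ℝ) : Prop
    extends IsWeakSolution b σ (P.map ξ) P 𝓕 W X where
  init_eq : ∀ᵐ ω ∂P, X 0 ω = ξ ω
  adapted_generated : ∀ t, Measurable[generatedCompletion P ξ W t] (X t)

end Stochastic

/-- The diffusion coefficient `a = σ σᵗ / 2`, in dimension one. -/
def diffusionCoeff (σ : unitInterval → ℝ → Measure ℝ → ℝ) :
    unitInterval → ℝ → Measure ℝ → ℝ :=
  fun t x m => σ t x m * σ t x m / 2

/-- Uniform ellipticity in dimension one: `Λ⁻¹ ≤ a ≤ Λ` for some `Λ > 1`. -/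
def UniformlyElliptic (a : unitInterval → ℝ → Measure ℝ → ℝ) : Prop :=
  ∃ Λ : ℝ, 1 < Λ ∧ ∀ (t : unitInterval) (x : ℝ) (m : Measure ℝ), IsProbabilityMeasure m →
    Λ⁻¹ ≤ a t x m ∧ a t x m ≤ Λ

/-! ### The example -/

/-- `c₁ = (2π)^{-1/2} ∫_{-2}^{2} exp(-|x|²/2) dx`. -/
def c₁ : ℝ := 1 / √(2 * Real.pi) * ∫ x in (-2 : ℝ)..2, Real.exp (-|x| ^ 2 / 2)

/-- `c₂ = (8π)^{-1/2} ∫_{-2}^{2} exp(-|x|²/8) dx`. -/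
def c₂ : ℝ := 1 / √(8 * Real.pi) * ∫ x in (-2 : ℝ)..2, Real.exp (-|x| ^ 2 / 8)

def lam₁ : ℝ := (2 * c₁ - c₂ - 1) / (c₁ - c₂)

def lam₂ : ℝ := (2 * c₁ - c₂) / (c₁ - c₂)

/-- `Σ(t, x) = λ₁ 1_{B₂}(x / √t) + λ₂ 1_{B₂ᶜ}(x / √t)`. At the single time `t = 0`, where the
quotient has no meaning, it is read as `0`. -/
def bigSigma (t : unitInterval) (x : ℝ) : ℝ :=
  lam₁ * (Metric.ball (0 : ℝ) 2).indicator (fun _ => 1) (x / √(t : ℝ))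
    + lam₂ * (Metric.ball (0 : ℝ) 2)ᶜ.indicator (fun _ => 1) (x / √(t : ℝ))

/-- `σ(t, m) = ∫ Σ(t, x) m(dx)`. -/
def sigma (t : unitInterval) (m : Measure ℝ) : ℝ := ∫ x, bigSigma t x ∂m

/-- `σ` as a coefficient of the equation; it does not depend on the space variable. -/
def sigmaCoeff : unitInterval → ℝ → Measure ℝ → ℝ := fun t _ m => sigma t m

/-- The drift `b ≡ 0`. -/
def zeroDrift : unitInterval → ℝ → Measure ℝ → ℝ := fun _ _ _ => 0

end DDSDE

end

namespace DDSDE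

open Set

/-! ### The constants -/

/-! The constants `c₁`, `c₂` are the masses that N(0,1) and N(0,4) give to B₂. By Brownian scaling,
`W t / √t` and `2 * W t / √t` have exactly these laws for every t > 0, so along both flows of laws σ
is constant in time (`sigma_gaussianReal`), and the linear system makes the constants 1 and 2. The
equation then reads dX = c dW with c = 1 or c = 2, solved by cW (`isStrongSolution_const_mul`).

Positivity rests on the one estimate 2c₁ - c₂ > 1 (`one_lt_two_mul_c₁_sub_c₂`). The regularity
claims hold because Σ(t, ·) takes two values, so that σ(t, ·) is an affine function of the mass of a
single set (`sigma_eq`). -/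

lemma gaussianReal_real_ball {v : NNReal} (hv : v ≠ 0) :
    (gaussianReal 0 v).real (Metric.ball 0 2) =
      1 / √(2 * Real.pi * v) * ∫ x in (-2 : ℝ)..2, Real.exp (-|x| ^ 2 / (2 * v)) := by
  rw [Measure.real, gaussianReal_apply_eq_integral 0 hv,
    ENNReal.toReal_ofReal (integral_nonneg fun x => gaussianPDFReal_nonneg _ _ _),
    intervalIntegral.integral_of_le (by norm_num), integral_Ioc_eq_integral_Ioo,
    Real.ball_eq_Ioo, ← integral_const_mul]
  norm_num [gaussianPDFReal, sq_abs]

lemma c₁_eq : c₁ = (gaussianReal 0 1).real (Metric.ball 0 2) := by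
  rw [gaussianReal_real_ball one_ne_zero, c₁]
  norm_num

lemma c₂_eq : c₂ = (gaussianReal 0 4).real (Metric.ball 0 2) := by
  rw [gaussianReal_real_ball four_ne_zero, c₂]
  congr 1
  · congr 2
    push_cast
    ring
  · norm_num

lemma c₁_le_one : c₁ ≤ 1 := c₁_eq ▸ measureReal_le_one

lemma integrable_gaussian_half : Integrable fun x : ℝ => Real.exp (-(1 / 2) * x ^ 2) :=
  integrable_exp_neg_mul_sq (by norm_num)

/-- On (2, ∞) the factor x / 2 is at least 1, and inserting it gives an integrand with
antiderivative -exp(-x² / 2) / 2. -/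
lemma integral_Ioi_two_gaussian_le :
    ∫ x in Ioi (2 : ℝ), Real.exp (-(1 / 2) * x ^ 2) ≤ Real.exp (-2) / 2 := by
  have hint : Integrable fun x : ℝ => x / 2 * Real.exp (-(1 / 2) * x ^ 2) := by
    convert (integrable_mul_exp_neg_mul_sq (b := 1 / 2) (by norm_num)).const_mul (1 / 2) using 2
    ring
  have hlim : Tendsto (fun x : ℝ => -(1 / 2) * Real.exp (-(1 / 2) * x ^ 2)) atTop (𝓝 0) := by
    have h : Tendsto (fun x : ℝ => -(1 / 2) * x ^ 2) atTop atBot :=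
      (tendsto_pow_atTop two_ne_zero).const_mul_atTop_of_neg (by norm_num)
    simpa only [mul_zero, Function.comp_def] using
      (Real.tendsto_exp_atBot.comp h).const_mul (-(1 / 2))
  have heq : ∫ x in Ioi (2 : ℝ), x / 2 * Real.exp (-(1 / 2) * x ^ 2) = Real.exp (-2) / 2 := by
    rw [integral_Ioi_of_hasDerivAt_of_tendsto' (fun x _ => ?_) hint.integrableOn hlim]
    · norm_num
      ring
    · refine ((((hasDerivAt_pow 2 x).const_mul (-(1 / 2))).exp).const_mul
        (-(1 / 2))).congr_deriv ?_
      norm_num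
      ring
  rw [← heq]
  refine setIntegral_mono_on integrable_gaussian_half.integrableOn hint.integrableOn
    measurableSet_Ioi fun x hx => ?_
  have : 1 ≤ x / 2 := by
    rw [mem_Ioi] at hx
    linarith
  exact le_mul_of_one_le_left (Real.exp_pos _).le this

lemma sqrt_two_pi_sub_le :
    √(2 * Real.pi) - Real.exp (-2) ≤ ∫ x in (-2 : ℝ)..2, Real.exp (-|x| ^ 2 / 2) := by
  have hfun : (fun x : ℝ => Real.exp (-|x| ^ 2 / 2)) = fun x => Real.exp (-(1 / 2) * x ^ 2) := by
    ext x
    rw [sq_abs]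
    ring_nf
  have hcont : Continuous fun x : ℝ => Real.exp (-(1 / 2) * x ^ 2) := by fun_prop
  have hneg : ∫ x in (-2 : ℝ)..0, Real.exp (-(1 / 2) * x ^ 2)
      = ∫ x in (0 : ℝ)..2, Real.exp (-(1 / 2) * x ^ 2) := by
    have := intervalIntegral.integral_comp_neg (a := 0) (b := 2)
      (fun x : ℝ => Real.exp (-(1 / 2) * x ^ 2))
    simp only [neg_sq, neg_zero] at this
    exact this.symm
  have hsplit := intervalIntegral.integral_interval_add_Ioi
    (integrable_gaussian_half.integrableOn (s := Ioi 0))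
    (integrable_gaussian_half.integrableOn (s := Ioi 2))
  have hgauss := integral_gaussian_Ioi (1 / 2)
  rw [show Real.pi / (1 / 2) = 2 * Real.pi by ring] at hgauss
  rw [hfun, ← intervalIntegral.integral_add_adjacent_intervals
    (hcont.intervalIntegrable (-2) 0) (hcont.intervalIntegrable 0 2), hneg]
  linarith [integral_Ioi_two_gaussian_le]

lemma integral_gaussian_quarter_le : ∫ x in (-2 : ℝ)..2, Real.exp (-|x| ^ 2 / 8) ≤ 4 := by
  have h : ∫ x in (-2 : ℝ)..2, Real.exp (-|x| ^ 2 / 8) ≤ ∫ _ in (-2 : ℝ)..2, (1 : ℝ) := by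
    refine intervalIntegral.integral_mono_on (by norm_num)
      (Continuous.intervalIntegrable (by fun_prop) _ _) (by simp) fun x _ => ?_
    rw [Real.exp_le_one_iff]
    have := sq_nonneg |x|
    linarith
  refine h.trans_eq ?_
  norm_num

/-- This is positivity of the numerator of `lam₁`; together with c₁ ≤ 1 it also gives c₂ < c₁. With
s = √(2π), the two integral bounds yield 2c₁ - c₂ ≥ 2 - (2 + 2e⁻²) / s. -/
lemma one_lt_two_mul_c₁_sub_c₂ : 1 < 2 * c₁ - c₂ := by
  -- It suffices that s > 2 + 2e⁻²; the values 2.3 and 0.15 match, as 2.3 = 2 + 2 · 0.15.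
  have hs : (2.3 : ℝ) < √(2 * Real.pi) := by
    rw [Real.lt_sqrt (by norm_num)]
    linarith [Real.pi_gt_three]
  have he : Real.exp (-2) < 0.15 := by
    have h1 : (7 : ℝ) < Real.exp 2 := by
      rw [show (2 : ℝ) = 1 + 1 by norm_num, Real.exp_add]
      nlinarith [Real.exp_one_gt_d9]
    rw [Real.exp_neg, inv_lt_comm₀ (by linarith) (by norm_num)]
    refine lt_trans ?_ h1
    norm_num
  have h8 : √(8 * Real.pi) = 2 * √(2 * Real.pi) := by
    rw [show 8 * Real.pi = 2 ^ 2 * (2 * Real.pi) by ring, Real.sqrt_mul (by norm_num),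
      Real.sqrt_sq (by norm_num)]
  have h1 : √(2 * Real.pi) * c₁ = ∫ x in (-2 : ℝ)..2, Real.exp (-|x| ^ 2 / 2) := by
    rw [c₁]
    field_simp
  have h2 : √(2 * Real.pi) * c₂ * 2 = ∫ x in (-2 : ℝ)..2, Real.exp (-|x| ^ 2 / 8) := by
    rw [c₂, h8]
    field_simp
  have h3 := sqrt_two_pi_sub_le
  have h4 := integral_gaussian_quarter_le
  by_contra! h
  nlinarith

lemma c₂_lt_c₁ : c₂ < c₁ := by linarith [one_lt_two_mul_c₁_sub_c₂, c₁_le_one]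

lemma lam₁_pos : 0 < lam₁ :=
  div_pos (by linarith [one_lt_two_mul_c₁_sub_c₂]) (sub_pos.2 c₂_lt_c₁)

lemma lam₁_lt_lam₂ : lam₁ < lam₂ :=
  div_lt_div_of_pos_right (by linarith) (sub_pos.2 c₂_lt_c₁)

/-- Cramer's rule: the determinant is c₁ - c₂. -/
lemma linear_system_iff (l₁ l₂ : ℝ) :
    (c₁ * l₁ + (1 - c₁) * l₂ = 1 ∧ c₂ * l₁ + (1 - c₂) * l₂ = 2) ↔ (l₁ = lam₁ ∧ l₂ = lam₂) := by
  have h : c₁ - c₂ ≠ 0 := (sub_pos.2 c₂_lt_c₁).ne'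
  rw [lam₁, lam₂]
  constructor
  · rintro ⟨h1, h2⟩
    constructor
    · rw [eq_div_iff h]
      linear_combination (1 - c₂) * h1 - (1 - c₁) * h2
    · rw [eq_div_iff h]
      linear_combination c₁ * h2 - c₂ * h1
  · rintro ⟨rfl, rfl⟩
    constructor <;> field_simp <;> ring

/-! ### The coefficient -/

/-- The set where `Σ(t, ·)` takes the value `λ₁`. -/
def innerSet (t : unitInterval) : Set ℝ := (fun x => x / √(t : ℝ)) ⁻¹' Metric.ball 0 2

lemma measurableSet_innerSet (t : unitInterval) : MeasurableSet (innerSet t) :=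
  (measurable_id.div_const _) Metric.isOpen_ball.measurableSet

/-- A single indicator remains, so integration only sees the mass of `innerSet t`. Time 0 needs no
separate case: x / 0 = 0 makes `innerSet 0` the whole line. -/
lemma bigSigma_eq (t : unitInterval) (x : ℝ) :
    bigSigma t x = lam₂ + (innerSet t).indicator (fun _ => lam₁ - lam₂) x := by
  by_cases h : x / √(t : ℝ) ∈ Metric.ball (0 : ℝ) 2
  · have h' : x ∈ innerSet t := h
    simp [bigSigma, -Metric.mem_ball, h, h']
  · have h' : x ∉ innerSet t := h
    simp [bigSigma, -Metric.mem_ball, h, h']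

lemma measurable_bigSigma (t : unitInterval) : Measurable (bigSigma t) := by
  rw [funext (bigSigma_eq t)]
  exact (measurable_const.indicator (measurableSet_innerSet t)).const_add _

lemma bigSigma_mem_Icc (t : unitInterval) (x : ℝ) : bigSigma t x ∈ Icc lam₁ lam₂ := by
  have := lam₁_lt_lam₂
  rw [bigSigma_eq]
  by_cases h : x ∈ innerSet t
  · simp [h, this.le]
  · simp [h, this.le]

lemma abs_bigSigma_le (t : unitInterval) (x : ℝ) : |bigSigma t x| ≤ lam₂ := by
  have h := bigSigma_mem_Icc t x
  rw [abs_of_pos (lam₁_pos.trans_le h.1)]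
  exact h.2

lemma integrable_bigSigma (t : unitInterval) (m : Measure ℝ) [IsFiniteMeasure m] :
    Integrable (bigSigma t) m :=
  Integrable.of_bound (measurable_bigSigma t).aestronglyMeasurable lam₂
    (ae_of_all _ fun x => abs_bigSigma_le t x)

lemma sigma_eq (t : unitInterval) (m : Measure ℝ) [IsProbabilityMeasure m] :
    sigma t m = lam₂ + (lam₁ - lam₂) * m.real (innerSet t) := by
  rw [sigma, funext (bigSigma_eq t), integral_add (integrable_const _)
    ((integrable_const _).indicator (measurableSet_innerSet t)),
    integral_indicator_const _ (measurableSet_innerSet t)]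
  simp [mul_comm]

lemma sigma_mem_Icc (t : unitInterval) (m : Measure ℝ) [IsProbabilityMeasure m] :
    sigma t m ∈ Icc lam₁ lam₂ := by
  have h := lam₁_lt_lam₂
  have h0 : 0 ≤ m.real (innerSet t) := measureReal_nonneg
  have h1 : m.real (innerSet t) ≤ 1 := measureReal_le_one
  rw [sigma_eq]
  constructor <;> nlinarith

lemma abs_bigSigma_sub_sigma_le (t : unitInterval) (m : Measure ℝ) [IsProbabilityMeasure m]
    (x : ℝ) : |bigSigma t x - sigma t m| ≤ lam₂ := by
  have h := bigSigma_mem_Icc t x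
  have h' := sigma_mem_Icc t m
  rw [abs_le]
  constructor <;> linarith [h.1, h.2, h'.1, h'.2, lam₁_pos]

lemma integral_bigSigma_sub_sigma (t : unitInterval) (m m' : Measure ℝ)
    [IsProbabilityMeasure m'] :
    ∫ y, (bigSigma t y - sigma t m) ∂m' = sigma t m' - sigma t m := by
  rw [integral_sub (integrable_bigSigma t m') (integrable_const _)]
  simp [sigma]

lemma uniformlyElliptic_diffusionCoeff : UniformlyElliptic (diffusionCoeff sigmaCoeff) := by
  have hpos : 0 < lam₁ ^ 2 / 2 := by
    have := lam₁_pos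
    positivity
  -- The last two terms handle the upper and the lower bound on a; the 2 forces Λ > 1.
  refine ⟨2 + lam₂ ^ 2 / 2 + (lam₁ ^ 2 / 2)⁻¹, ?_, fun t x m hm => ?_⟩
  · have := inv_pos.2 hpos
    have := sq_nonneg lam₂
    linarith
  have h := sigma_mem_Icc t m
  have h1 := lam₁_pos
  have hinv := inv_pos.2 hpos
  have hsq := sq_nonneg lam₂
  simp only [diffusionCoeff, sigmaCoeff]
  constructor
  · refine (inv_le_of_inv_le₀ hpos (by linarith)).trans ?_
    nlinarith [h.1]
  · nlinarith [h.1, h.2]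

lemma abs_sigma_sub_sigma_le (t : unitInterval) (m m' : Measure ℝ)
    [IsProbabilityMeasure m] [IsProbabilityMeasure m'] :
    |sigma t m - sigma t m'| ≤ (lam₂ - lam₁) * tvDist m m' := by
  have hS := measurableSet_innerSet t
  have h : |m.real (innerSet t) - m'.real (innerSet t)| ≤ tvDist m m' := by
    have h1 := SignedMeasure.norm_le_totalVariation
      (m.toSignedMeasure - m'.toSignedMeasure) (innerSet t)
    rw [sub_apply, Measure.toSignedMeasure_apply_measurable hS,
      Measure.toSignedMeasure_apply_measurable hS] at h1
    exact h1.trans (measureReal_mono (subset_univ _))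
  rw [sigma_eq, sigma_eq, show lam₂ + (lam₁ - lam₂) * m.real (innerSet t) -
    (lam₂ + (lam₁ - lam₂) * m'.real (innerSet t)) =
    -((lam₂ - lam₁) * (m.real (innerSet t) - m'.real (innerSet t))) by ring, abs_neg, abs_mul,
    abs_of_pos (sub_pos.2 lam₁_lt_lam₂)]
  exact mul_le_mul_of_nonneg_left h (sub_pos.2 lam₁_lt_lam₂).le

/-! ### The linear functional derivative -/

lemma sigma_mix (t : unitInterval) (m m' : Measure ℝ) [IsProbabilityMeasure m]
    [IsProbabilityMeasure m'] {ε : ℝ} (h0 : 0 ≤ ε) (h1 : ε ≤ 1) :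
    sigma t (mix ε m m') = sigma t m + ε * (sigma t m' - sigma t m) := by
  rw [sigma, mix, integral_add_measure
    ((integrable_bigSigma t m).smul_measure ENNReal.ofReal_ne_top)
    ((integrable_bigSigma t m').smul_measure ENNReal.ofReal_ne_top), integral_smul_measure,
    integral_smul_measure, ENNReal.toReal_ofReal (by linarith), ENNReal.toReal_ofReal h0]
  simp only [smul_eq_mul, sigma]
  ring

lemma tendsto_sigma_mix (t : unitInterval) (m m' : Measure ℝ) [IsProbabilityMeasure m]
    [IsProbabilityMeasure m'] :
    Tendsto (fun ε : ℝ => (sigma t (mix ε m m') - sigma t m) / ε) (𝓝[>] 0)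
      (𝓝 (sigma t m' - sigma t m)) := by
  refine tendsto_const_nhds.congr' ?_
  -- As σ is affine along mixtures, the quotient is constant for 0 < ε ≤ 1; beyond 1,
  -- `ENNReal.ofReal (1 - ε)` is truncated to 0.
  filter_upwards [Ioc_mem_nhdsGT (zero_lt_one (α := ℝ))] with ε hε
  rw [sigma_mix t m m' hε.1.le hε.2, add_sub_cancel_left, mul_div_cancel_left₀ _ hε.1.ne']

lemma hasLinearFunctionalDeriv_bigSigma {φ : ℝ → ℝ} (hφ : IsWeight φ) (t : unitInterval) :
    HasLinearFunctionalDeriv φ (sigma t) (fun _ y => bigSigma t y) where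
  measurable _ _ := measurable_bigSigma t
  bound K _ := ⟨lam₂, fun _ _ y => (abs_bigSigma_le t y).trans
    (le_mul_of_one_le_right (lam₁_pos.trans lam₁_lt_lam₂).le (hφ.one_le y))⟩
  deriv m m' hm hm' := by
    have := hm.isProb
    have := hm'.isProb
    exact tendsto_sigma_mix t m m'

lemma hasLinearFunctionalDeriv_bigSigma_sub {φ : ℝ → ℝ} (hφ : IsWeight φ) (t : unitInterval) :
    HasLinearFunctionalDeriv φ (sigma t) (fun m y => bigSigma t y - sigma t m) where
  measurable _ _ := (measurable_bigSigma t).sub_const _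
  bound K hK := ⟨lam₂, fun m hm y => by
    have := (hK.1 m hm).isProb
    exact (abs_bigSigma_sub_sigma_le t m y).trans
      (le_mul_of_one_le_right (lam₁_pos.trans lam₁_lt_lam₂).le (hφ.one_le y))⟩
  deriv m m' hm hm' := by
    have := hm.isProb
    have := hm'.isProb
    rw [integral_bigSigma_sub_sigma, integral_bigSigma_sub_sigma, sub_self, sub_zero]
    exact tendsto_sigma_mix t m m'

/-! ### The coefficient along centered Gaussian laws -/

/-- Division by √t carries N(0, vt) to N(0, v), so the mass of `innerSet t` does not depend on t. -/
lemma sigma_gaussianReal {t : unitInterval} (ht : 0 < t) (v : NNReal) :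
    sigma t (gaussianReal 0 (v * Real.toNNReal t)) =
      lam₂ + (lam₁ - lam₂) * (gaussianReal 0 v).real (Metric.ball 0 2) := by
  have ht' : (0 : ℝ) < t := ht
  have hmap : (gaussianReal 0 (v * Real.toNNReal t)).map (fun x => x / √(t : ℝ))
      = gaussianReal 0 v := by
    rw [gaussianReal_map_div_const, zero_div]
    congr 1
    ext
    simp only [NNReal.coe_div, NNReal.coe_mul, Real.coe_toNNReal _ ht'.le, NNReal.coe_mk,
      Real.sq_sqrt ht'.le]
    field_simp
  rw [sigma_eq, ← hmap, innerSet, map_measureReal_apply (by fun_prop)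
    Metric.isOpen_ball.measurableSet]

lemma sigma_gaussianReal_one {t : unitInterval} (ht : 0 < t) :
    sigma t (gaussianReal 0 (Real.toNNReal t)) = 1 := by
  have h := sigma_gaussianReal ht 1
  rw [one_mul, ← c₁_eq] at h
  rw [h]
  linear_combination ((linear_system_iff _ _).2 ⟨rfl, rfl⟩).1

lemma sigma_gaussianReal_four {t : unitInterval} (ht : 0 < t) :
    sigma t (gaussianReal 0 (4 * Real.toNNReal t)) = 2 := by
  rw [sigma_gaussianReal ht 4, ← c₂_eq]
  linear_combination ((linear_system_iff _ _).2 ⟨rfl, rfl⟩).2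

/-! ### Multiples of Brownian motion as solutions -/

section BrownianMotion

variable {Ω : Type*} [mΩ : MeasurableSpace Ω] {P : Measure Ω} {𝓕 : Filtration unitInterval mΩ}
  {W : unitInterval → Ω → ℝ}

lemma IsBrownianMotion.measurable (hW : IsBrownianMotion P 𝓕 W) (t : unitInterval) :
    Measurable (W t) :=
  (hW.adapted t).mono (𝓕.le t) le_rfl

lemma IsBrownianMotion.map_eq (hW : IsBrownianMotion P 𝓕 W) (t : unitInterval) :
    P.map (W t) = gaussianReal 0 (Real.toNNReal t) := by
  have h := hW.law 0 t t.2.1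
  rw [Icc.coe_zero, sub_zero] at h
  rw [← h]
  refine Measure.map_congr ?_
  filter_upwards [hW.zero] with ω hω
  rw [hω, sub_zero]

lemma IsBrownianMotion.map_two_mul_eq (hW : IsBrownianMotion P 𝓕 W) (t : unitInterval) :
    P.map (fun ω => 2 * W t ω) = gaussianReal 0 (4 * Real.toNNReal t) := by
  have h := Measure.map_map (μ := P) (measurable_const_mul (2 : ℝ)) (hW.measurable t)
  rw [hW.map_eq, gaussianReal_map_const_mul, mul_zero] at h
  refine h.symm.trans ?_
  congr 2
  ext
  norm_num

/-- The constant process `c` on `(0, 1]`. -/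
def SimpleProcess.const (𝓕 : Filtration unitInterval mΩ) (c : ℝ) : SimpleProcess 𝓕 where
  n := 1
  time := ![0, 1]
  time_mono := by
    rw [Fin.monotone_iff_le_succ]
    intro i
    fin_cases i
    exact unitInterval.nonneg'
  coef _ _ := c
  coef_measurable _ := measurable_const
  coef_bounded := ⟨|c|, fun _ _ => le_rfl⟩

lemma SimpleProcess.const_eval (c : ℝ) {s : unitInterval} (hs : 0 < s) (ω : Ω) :
    (SimpleProcess.const 𝓕 c).eval s ω = c := by
  have h : s ∈ Ioc (0 : unitInterval) 1 := ⟨hs, unitInterval.le_one'⟩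
  exact (Fin.sum_univ_one _).trans (indicator_of_mem h _)

lemma SimpleProcess.const_integral (c : ℝ) (W : unitInterval → Ω → ℝ) (t : unitInterval) (ω : Ω) :
    (SimpleProcess.const 𝓕 c).integral W t ω = c * (W t ω - W 0 ω) := by
  have h1 : min 1 t = t := min_eq_right unitInterval.le_one'
  have h0 : min 0 t = 0 := min_eq_left unitInterval.nonneg'
  refine (Fin.sum_univ_one _).trans ?_
  change c * (W (min 1 t) ω - W (min 0 t) ω) = _
  rw [h1, h0]

/-- The value `h 0` is left free because σ equals λ₁ at time 0. Since {0} is Lebesgue null, the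
constant simple process has zero L² distance to `h`, and its integral c(W_t - W_0) is c W_t almost
surely; a constant approximating sequence suffices. -/
lemma isItoIntegral_const_mul [IsProbabilityMeasure P] (hW : IsBrownianMotion P 𝓕 W) {c : ℝ}
    {h : unitInterval → ℝ} (hh : ∀ t, 0 < t → h t = c) :
    IsItoIntegral P 𝓕 W (fun s _ => h s) (fun t ω => c * W t ω) := by
  have hae : ∀ᵐ s : unitInterval, 0 < s := by
    filter_upwards [compl_mem_ae_iff.2 (measure_singleton (0 : unitInterval))] with s hs
    exact unitInterval.pos_iff_ne_zero.2 hs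
  have hmeas : Measurable h := by
    have : h = fun s => if s = 0 then h 0 else c := by
      ext s
      split_ifs with hs
      · rw [hs]
      · exact hh s (unitInterval.pos_iff_ne_zero.2 hs)
    rw [this]
    exact Measurable.ite (measurableSet_singleton 0) measurable_const measurable_const
  refine ⟨fun i => ?_, ae_of_all _ fun ω => ?_, fun t => (hW.adapted t).const_mul c, ?_,
    fun _ => SimpleProcess.const 𝓕 c, fun δ hδ => ?_, fun δ hδ => ?_⟩
  · exact hmeas.comp (measurable_subtype_coe.comp measurable_fst)
  · rw [lintegral_congr_ae (g := fun _ => ENNReal.ofReal (c ^ 2))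
      (hae.mono fun s hs => by simp only [hh s hs])]
    simp
  · filter_upwards [hW.cont] with ω hω using hω.const_mul c
  · have hzero : ∀ ω, ∫⁻ s : unitInterval,
        ENNReal.ofReal (((SimpleProcess.const 𝓕 c).eval s ω - h s) ^ 2) = 0 := by
      intro ω
      rw [lintegral_congr_ae (g := fun _ => 0) (hae.mono fun s hs => by
        simp [hh s hs, SimpleProcess.const_eval c hs])]
      simp
    simp [hzero, hδ.not_ge]
  · refine tendsto_const_nhds.congr fun _ => Eq.symm ?_
    rw [← compl_mem_ae_iff]
    filter_upwards [hW.zero] with ω hω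
    simp [SimpleProcess.const_integral, hω, hδ]

/-- The hypothesis `hc` is a self-consistency condition: the law of cW must reproduce the
coefficient c. -/
lemma isStrongSolution_const_mul [IsProbabilityMeasure P] (hP : UsualConditions P 𝓕)
    (hW : IsBrownianMotion P 𝓕 W) {c : ℝ}
    (hc : ∀ t : unitInterval, 0 < t → sigma t (P.map fun ω => c * W t ω) = c) :
    IsStrongSolution zeroDrift sigmaCoeff (fun _ => 0) P 𝓕 W (fun t ω => c * W t ω) where
  isProb := inferInstance
  usual := hP
  brownian := hW
  adapted t := (hW.adapted t).const_mul c
  cont := by filter_upwards [hW.cont] with ω hω using hω.const_mul c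
  init := Measure.map_congr (by filter_upwards [hW.zero] with ω hω; simp [hω])
  drift_integrable := ae_of_all _ fun _ => integrable_zero _ _ _
  eqn := by
    refine ⟨fun t ω => c * W t ω, isItoIntegral_const_mul hW hc, fun t => ?_⟩
    filter_upwards [hW.zero] with ω hω
    simp [hω, zeroDrift]
  init_eq := by filter_upwards [hW.zero] with ω hω; simp [hω]
  adapted_generated t := by
    have hle : MeasurableSpace.comap (W t) inferInstance ≤
        generatedCompletion P (fun _ => 0) W t :=
      (le_iSup (fun s : Iic t => MeasurableSpace.comap (W s) inferInstance) ⟨t, self_mem_Iic⟩).trans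
        (le_sup_right.trans le_sup_left)
    exact ((comap_measurable (W t)).mono hle le_rfl).const_mul c

end BrownianMotion

end DDSDE

theorem mainTheorem5 :
    -- the linear system has exactly one solution, and it satisfies `0 < λ₁ < λ₂`
    (∀ l₁ l₂ : ℝ,
      (DDSDE.c₁ * l₁ + (1 - DDSDE.c₁) * l₂ = 1 ∧ DDSDE.c₂ * l₁ + (1 - DDSDE.c₂) * l₂ = 2) ↔
        (l₁ = DDSDE.lam₁ ∧ l₂ = DDSDE.lam₂)) ∧
    0 < DDSDE.lam₁ ∧ DDSDE.lam₁ < DDSDE.lam₂ ∧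
    -- two-sided bounds and uniform ellipticity
    (∀ (t : unitInterval) (m : Measure ℝ) [IsProbabilityMeasure m],
      DDSDE.lam₁ ≤ DDSDE.sigma t m ∧ DDSDE.sigma t m ≤ DDSDE.lam₂) ∧
    DDSDE.UniformlyElliptic (DDSDE.diffusionCoeff DDSDE.sigmaCoeff) ∧
    -- Lipschitz continuity in total variation, uniformly in time
    (∃ C : ℝ, ∀ (t : unitInterval) (m m' : Measure ℝ)
      [IsProbabilityMeasure m] [IsProbabilityMeasure m'],
      |DDSDE.sigma t m - DDSDE.sigma t m'| ≤ C * DDSDE.tvDist m m') ∧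
    -- `Σ(t, ·)` is a linear functional derivative of `σ(t, ·)`, and so is its normalized
    -- version `Σ(t, ·) - σ(t, m)`; both are uniformly bounded
    (∀ (φ : ℝ → ℝ), DDSDE.IsWeight φ → ∀ t : unitInterval,
      DDSDE.HasLinearFunctionalDeriv φ (DDSDE.sigma t) (fun _ y => DDSDE.bigSigma t y) ∧
      DDSDE.HasLinearFunctionalDeriv φ (DDSDE.sigma t)
        (fun m y => DDSDE.bigSigma t y - DDSDE.sigma t m)) ∧
    (∀ (t : unitInterval) (m : Measure ℝ) [IsProbabilityMeasure m],
      ∫ y, (DDSDE.bigSigma t y - DDSDE.sigma t m) ∂m = 0) ∧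
    (∃ C : ℝ, ∀ (t : unitInterval) (m : Measure ℝ) [IsProbabilityMeasure m] (y : ℝ),
      |DDSDE.bigSigma t y| ≤ C ∧ |DDSDE.bigSigma t y - DDSDE.sigma t m| ≤ C) ∧
    -- for every Brownian motion `W`, both `W` and `2W` are strong solutions started from `0`, and
    -- they have different laws at every positive time
    (∀ {Ω : Type*} [mΩ : MeasurableSpace Ω] (P : Measure Ω) [IsProbabilityMeasure P]
      (𝓕 : Filtration unitInterval mΩ) (W : unitInterval → Ω → ℝ),
      DDSDE.UsualConditions P 𝓕 → DDSDE.IsBrownianMotion P 𝓕 W →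
        (∀ t : unitInterval, 0 < t →
          DDSDE.sigma t (P.map (W t)) = 1 ∧
          DDSDE.sigma t (P.map (fun ω => 2 * W t ω)) = 2) ∧
        DDSDE.IsStrongSolution DDSDE.zeroDrift DDSDE.sigmaCoeff (fun _ => 0) P 𝓕 W W ∧
        DDSDE.IsStrongSolution DDSDE.zeroDrift DDSDE.sigmaCoeff (fun _ => 0) P 𝓕 W
          (fun t ω => 2 * W t ω) ∧
        (∀ t : unitInterval, 0 < t → P.map (W t) ≠ P.map (fun ω => 2 * W t ω)) ∧
        ¬ (∀ᵐ ω ∂P, ∀ t : unitInterval, W t ω = 2 * W t ω)) := by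

  refine ⟨DDSDE.linear_system_iff, DDSDE.lam₁_pos, DDSDE.lam₁_lt_lam₂,
    fun t m _ => DDSDE.sigma_mem_Icc t m, DDSDE.uniformlyElliptic_diffusionCoeff,
    ⟨DDSDE.lam₂ - DDSDE.lam₁, fun t m m' _ _ => DDSDE.abs_sigma_sub_sigma_le t m m'⟩,
    fun φ hφ t => ⟨DDSDE.hasLinearFunctionalDeriv_bigSigma hφ t,
      DDSDE.hasLinearFunctionalDeriv_bigSigma_sub hφ t⟩,
    fun t m _ => by rw [DDSDE.integral_bigSigma_sub_sigma, sub_self],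
    ⟨DDSDE.lam₂, fun t m _ y =>
      ⟨DDSDE.abs_bigSigma_le t y, DDSDE.abs_bigSigma_sub_sigma_le t m y⟩⟩, ?_⟩
  intro Ω mΩ P _ 𝓕 W hP hW
  have h1 : ∀ t : unitInterval, 0 < t → DDSDE.sigma t (P.map (W t)) = 1 := fun t ht => by
    rw [hW.map_eq, DDSDE.sigma_gaussianReal_one ht]
  have h2 : ∀ t : unitInterval, 0 < t → DDSDE.sigma t (P.map fun ω => 2 * W t ω) = 2 :=
    fun t ht => by rw [hW.map_two_mul_eq, DDSDE.sigma_gaussianReal_four ht]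
  -- The functional σ(t, ·) itself separates the two laws, by its values 1 and 2.
  have hne : ∀ t : unitInterval, 0 < t → P.map (W t) ≠ P.map (fun ω => 2 * W t ω) :=
    fun t ht heq => by
      have h := h2 t ht
      rw [← heq, h1 t ht] at h
      norm_num at h
  refine ⟨fun t ht => ⟨h1 t ht, h2 t ht⟩, ?_, DDSDE.isStrongSolution_const_mul hP hW h2, hne,
    fun h => hne 1 zero_lt_one (Measure.map_congr (h.mono fun ω hω => hω 1))⟩
  simpa only [one_mul] using
    DDSDE.isStrongSolution_const_mul (c := 1) hP hW (by simpa only [one_mul] using h1)
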